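/- Let $(E,\mathcal B)$ be a measurable space and let $m$ be a nonzero finite positive measure on it. Assume that $(P_t)_{t\ge 0}$ and $m$ satisfy one of the following two conditions. (A$_1$) For some $1\le p<\infty$, $(P_t)_{t\ge0}$ is a strongly continuous semigroup of Markovian operators on the real space $L^p(m)$: the $P_t$ are linear operators on $L^p(m)$ with $P_0=\mathrm{Id}$ and $P_{s+t}=P_sP_t$, the map $t\mapsto P_tf\in L^p(m)$ is continuous on $[0,\infty)$ for every $f\in L^p(m)$, $P_tf\ge 0$ whenever $f\ge0$, and $P_t1=1$. (A$_2$) $(P_t)_{t\ge0}$ is a measurable Markovian transition function on $(E,\mathcal B)$, i.e. a family of Markov kernels, $P_tf(x)=\int f(y)\,P_t(x,dy)$, such that $P_t(P_sf)=P_{s+t}f$ for all $s,t\ge0$ and all positive measurable $f$, and such that $(t,x)\mapsto P_tf(x)$ is measurable on $[0,\infty)\times E$ for all positive measurable $f$; moreover, $m(f)=0$ implies $m(P_tf)=0$ for all $t>0$ and all positive measurable $f$. Here $m(f)=\int f\,dm$. A finite measure $\nu$ (absolutely continuous with respect to $m$ in case (A$_1$)) is called invariant for $(P_t)_{t\ge0}$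 if $\int P_tf\,d\nu=\int f\,d\nu$ for all $t>0$ and all bounded measurable $f$. Write $(t_n)_n\nearrow\infty$ for a nondecreasing sequence of positive real numbers tending to infinity. For such a sequence put $$c((P_t)_t,m,(t_n)_n):=\lim_{\varepsilon\searrow0}\ \sup_{A\in\mathcal B,\ m(A)\le\varepsilon}\ \sup_n\ \frac1{t_n}\int_0^{t_n}m(P_s1_A)\,ds .$$ A set function $\phi:\mathcal B\to[0,\infty)$ is called absolutely continuous with respect to $m$ if $\lim_{m(A)\to0}\phi(A)=0$, i.e. for every $\varepsilon>0$ there is $\eta>0$ such that $\phi(A)\le\varepsilon$ for all $A\in\mathcal B$ with $m(A)\le\eta$. The measure $m$ is called almost invariant if there exist $\delta\in[0,1)$ and a set function $\phi:\mathcal B\to[0,\infty)$ that is absolutely continuous with respect to $m$ such that $$m(P_t1_A)\le\delta\, m(E)+\phi(A)\qquad\text{for all } t>0,\ A\in\mathcal B,$$ and mean almost invariant with respect to $(t_n)_n\nearrow\infty$ if there exist such $\delta$ and $\phi$ with $$\frac1{t_n}\int_0^{t_n}m(P_s1_A)\,ds\le\delta\, m(E)+\phi(A)\qquad\text{for all }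 n,\ A\in\mathcal B.$$ Then the following assertions are equivalent. i) There exists a nonzero finite positive measure that is invariant for $(P_t)_{t\ge0}$ and absolutely continuous with respect to $m$. ii) $m$ is almost invariant. iii) $m$ is mean almost invariant with respect to every sequence $(t_n)_n\nearrow\infty$. iv) $c((P_t)_t,m,(t_n)_n)<m(E)$ for all sequences $(t_n)_n\nearrow\infty$. v) $c((P_t)_t,m,(t_n)_n)<m(E)$ for some sequence $(t_n)_n\nearrow\infty$. -/

import Mathlib

open MeasureTheory ProbabilityTheory Filter Topology
open scoped ENNReal NNReal

namespace InvMeas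

variable {E : Type*} [MeasurableSpace E]

/-- The σ-algebra of `E`, as a type: the measurable subsets. -/
abbrev MSet (E : Type*) [MeasurableSpace E] : Type _ := {A : Set E // MeasurableSet A}

/-! ### The two settings -/

/-- `(P_t)_{t ≥ 0}` is a strongly continuous semigroup of Markovian operators on the real space
`L^p(m)`. No boundedness is required: the operators are linear and positivity preserving. -/
structure IsMarkovianC0Semigroup (p : ℝ≥0∞) [Fact (1 ≤ p)] (m : Measure E) [IsFiniteMeasure m]
    (P : ℝ≥0 → Lp ℝ p m →ₗ[ℝ] Lp ℝ p m) : Prop where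
  zero : P 0 = LinearMap.id
  add : ∀ s t, P (s + t) = P s ∘ₗ P t
  strongly_continuous : ∀ f : Lp ℝ p m, Continuous fun t => P t f
  positive : ∀ t, ∀ f : Lp ℝ p m, 0 ≤ f → 0 ≤ P t f
  map_one : ∀ t, P t (Lp.const p m (1 : ℝ)) = Lp.const p m (1 : ℝ)

/-- `(P_t)_{t ≥ 0}` is a measurable Markovian transition function on `E`. Since
`P_t f (x) = ∫ f(y) P_t(x, dy)`, the field `add` says `P_t (P_s f) = P_{t+s} f`. -/
structure IsMeasurableMarkovianTransition (P : ℝ≥0 → Kernel E E) : Prop where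
  markov : ∀ t, IsMarkovKernel (P t)
  add : ∀ s t, ∀ f : E → ℝ≥0∞, Measurable f → ∀ x,
    ∫⁻ y, ∫⁻ z, f z ∂(P s y) ∂(P t x) = ∫⁻ z, f z ∂(P (s + t) x)
  measurable : ∀ f : E → ℝ≥0∞, Measurable f →
    Measurable fun z : ℝ≥0 × E => ∫⁻ y, f y ∂(P z.1 z.2)

/-- `m` is an auxiliary measure for `(P_t)`: `m(f) = 0` implies `m(P_t f) = 0`, for all `t > 0` and
all positive measurable functions `f`. -/
def IsAuxiliary (m : Measure E) (P : ℝ≥0 → Kernel E E) : Prop :=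
  ∀ t, 0 < t → ∀ f : E → ℝ≥0∞, Measurable f →
    ∫⁻ x, f x ∂m = 0 → ∫⁻ x, ∫⁻ y, f y ∂(P t x) ∂m = 0

/-! ### Invariant measures -/

/-- The class in `L^p(m)` of a bounded measurable function. -/
noncomputable def bddToLp (p : ℝ≥0∞) (m : Measure E) [IsFiniteMeasure m] (f : E → ℝ)
    (hf : Measurable f) (C : ℝ) (hC : ∀ x, |f x| ≤ C) : Lp ℝ p m :=
  (MemLp.of_bound hf.aestronglyMeasurable C (ae_of_all m hC) : MemLp f p m).toLp f

/-- Invariance of a measure `ν` for operators on `L^p(m)`: `∫ P_t f dν = ∫ f dν` for `t > 0` and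
`f` bounded measurable. It is used for `ν ≪ m` only, where `∫ P_t f dν` does not depend on the
representative of `P_t f`. -/
def IsInvariantLp (p : ℝ≥0∞) [Fact (1 ≤ p)] (m : Measure E) [IsFiniteMeasure m]
    (P : ℝ≥0 → Lp ℝ p m →ₗ[ℝ] Lp ℝ p m) (ν : Measure E) : Prop :=
  ∀ t, 0 < t → ∀ (f : E → ℝ) (hf : Measurable f) (C : ℝ) (hC : ∀ x, |f x| ≤ C),
    ∫ x, (P t (bddToLp p m f hf C hC)) x ∂ν = ∫ x, f x ∂ν

/-- Invariance of a measure `ν` for kernels: `∫ P_t f dν = ∫ f dν` for `t > 0` and `f` bounded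
measurable. -/
def IsInvariantKernel (P : ℝ≥0 → Kernel E E) (ν : Measure E) : Prop :=
  ∀ t, 0 < t → ∀ f : E → ℝ, Measurable f → ∀ C : ℝ, (∀ x, |f x| ≤ C) →
    ∫ x, ∫ y, f y ∂(P t x) ∂ν = ∫ x, f x ∂ν

/-! ### The quantities `m(P_t 1_A)` -/

/-- `m(P_t 1_A)` for positivity preserving operators on `L^p(m)`. -/
noncomputable def massLp (p : ℝ≥0∞) [Fact (1 ≤ p)] (m : Measure E) [IsFiniteMeasure m]
    (P : ℝ≥0 → Lp ℝ p m →ₗ[ℝ] Lp ℝ p m) (t : ℝ≥0) (A : MSet E) : ℝ≥0∞ :=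
  ∫⁻ x, ENNReal.ofReal ((P t (indicatorConstLp p A.2 (measure_ne_top m A.1) (1 : ℝ))) x) ∂m

/-- `m(P_t 1_A)` for kernels, where `P_t 1_A (x) = P_t(x, A)`. -/
noncomputable def massKernel (m : Measure E) (P : ℝ≥0 → Kernel E E) (t : ℝ≥0) (A : MSet E) :
    ℝ≥0∞ :=
  ∫⁻ x, P t x A.1 ∂m

/-! ### Almost invariance and the index

These depend on `(P_t)` and `m` only through `q t A = m(P_t 1_A)` and `m`. -/

/-- `(1/T) ∫_0^T m(P_s 1_A) ds`. -/
noncomputable def timeAverage (q : ℝ≥0 → MSet E → ℝ≥0∞) (T : ℝ) (A : MSet E) : ℝ≥0∞ :=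
  (ENNReal.ofReal T)⁻¹ * ∫⁻ s in Set.Ioc (0 : ℝ) T, q s.toNNReal A

/-- A sequence of positive real numbers increasing to infinity. -/
structure IncreasesToInfinity (t : ℕ → ℝ) : Prop where
  pos : ∀ n, 0 < t n
  mono : Monotone t
  tendsto : Tendsto t atTop atTop

/-- The set function `φ` is absolutely continuous with respect to `m`: `φ(A) → 0` as
`m(A) → 0`. -/
def SetFunAbsCont (m : Measure E) (φ : MSet E → ℝ≥0) : Prop :=
  ∀ ε : ℝ≥0, 0 < ε → ∃ η : ℝ≥0, 0 < η ∧ ∀ A : MSet E, m A.1 ≤ η → φ A ≤ ε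

/-- `m` is almost invariant: `m(P_t 1_A) ≤ δ m(E) + φ(A)` for all `t > 0` and measurable `A`. -/
def IsAlmostInvariant (m : Measure E) (q : ℝ≥0 → MSet E → ℝ≥0∞) : Prop :=
  ∃ δ : ℝ≥0, δ < 1 ∧ ∃ φ : MSet E → ℝ≥0, SetFunAbsCont m φ ∧
    ∀ t, 0 < t → ∀ A : MSet E, q t A ≤ δ * m Set.univ + φ A

/-- `m` is mean almost invariant with respect to the sequence `(t_n)`. -/
def IsMeanAlmostInvariant (m : Measure E) (q : ℝ≥0 → MSet E → ℝ≥0∞) (t : ℕ → ℝ) : Prop :=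
  ∃ δ : ℝ≥0, δ < 1 ∧ ∃ φ : MSet E → ℝ≥0, SetFunAbsCont m φ ∧
    ∀ n, ∀ A : MSet E, timeAverage q (t n) A ≤ δ * m Set.univ + φ A

/-- `sup_{m(A) ≤ ε} sup_n (1/t_n) ∫_0^{t_n} m(P_s 1_A) ds`. -/
noncomputable def indexAt (m : Measure E) (q : ℝ≥0 → MSet E → ℝ≥0∞) (t : ℕ → ℝ) (ε : ℝ≥0∞) :
    ℝ≥0∞ :=
  ⨆ (A : MSet E) (_ : m A.1 ≤ ε), ⨆ n, timeAverage q (t n) A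

/-- The index `c((P_t), m, (t_n))`, the limit of `indexAt m q t ε` as `ε ↘ 0`. -/
noncomputable def index (m : Measure E) (q : ℝ≥0 → MSet E → ℝ≥0∞) (t : ℕ → ℝ) : ℝ≥0∞ :=
  limUnder (𝓝[>] (0 : ℝ≥0∞)) (indexAt m q t)

theorem indexAt_mono (m : Measure E) (q : ℝ≥0 → MSet E → ℝ≥0∞) (t : ℕ → ℝ) :
    Monotone (indexAt m q t) := fun _ _ h =>
  iSup_mono fun _ => iSup_le fun hA => le_iSup_of_le (hA.trans h) le_rfl

/-- The limit that defines the index always exists. -/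
theorem tendsto_indexAt (m : Measure E) (q : ℝ≥0 → MSet E → ℝ≥0∞) (t : ℕ → ℝ) :
    Tendsto (indexAt m q t) (𝓝[>] (0 : ℝ≥0∞)) (𝓝 (index m q t)) :=
  tendsto_nhds_limUnder ⟨_, (indexAt_mono m q t).tendsto_nhdsGT 0⟩

end InvMeas

/-! Both settings reduce to one abstract object, `IsMarkovFamily`: Markov operators modulo null sets
on nonnegative essentially bounded functions. For kernels, the auxiliary condition on `m` makes the
operators compatible with null sets. On `L^p`, positivity forces boundedness
(`exists_bound_of_positive`), and continuity together with `p < ∞` gives countable additivity on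
sets.

The substantial implication goes from the index to an invariant measure (`exists_invariant`). An
ultrafilter limit of the time averages of `m` is a finitely additive functional `Λ` with `Λ(1) =
m(E)` and `Λ ∘ T_s ≤ Λ`. Let `ν` be the largest measure below `Λ` on sets. The image of `ν` under
`T_s` is again a measure below `Λ`, hence below `ν`; it has the same finite mass, so it equals `ν`.
If `ν` were zero, `E` would have a countable cover of small total `Λ`-weight. The complements of
finite subcovers have `m`-measure tending to zero, so the index bounds their `Λ`-weight, and finite
additivity would give `Λ(1) < m(E)`.

Conversely (`isAlmostInvariant`), if `g = dν/dm` and `B = {g ≥ c}` has positive `m`-measure, then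
`m(T_t 1_A) ≤ m(Bᶜ) + ν(A) / c`. The remaining implications average this kind of bound in time and
let `m(A)` tend to zero. -/

namespace InvMeas

variable {E : Type*} [MeasurableSpace E]

/-! ### The largest measure below a finitely additive set function -/

section LargestMeasure

/-- The outer measure induced by a set function on the measurable sets. -/
noncomputable def lowerOuter (μ : Set E → ℝ≥0∞) (h0 : μ ∅ = 0) : OuterMeasure E :=
  OuterMeasure.ofFunction (fun A => ⨅ _ : MeasurableSet A, μ A) (by simp [h0])

/-- The splitting criterion need only be checked on the generating weights. There it is finite
additivity for a measurable set, and trivial for any other set, whose weight is an empty infimum,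
`∞`. -/
theorem le_caratheodory_lowerOuter {μ : Set E → ℝ≥0∞} (h0 : μ ∅ = 0)
    (hadd : ∀ A B, MeasurableSet A → MeasurableSet B → Disjoint A B → μ (A ∪ B) = μ A + μ B) :
    ‹MeasurableSpace E› ≤ (lowerOuter μ h0).caratheodory := by
  intro s hs
  refine OuterMeasure.ofFunction_caratheodory fun t => ?_
  refine le_iInf fun ht => ?_
  rw [iInf_pos (ht.inter hs), iInf_pos (ht.diff hs),
    ← hadd _ _ (ht.inter hs) (ht.diff hs) Set.disjoint_sdiff_inter.symm, Set.inter_union_sdiff]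

variable {μ : Set E → ℝ≥0∞} (h0 : μ ∅ = 0)
  (hadd : ∀ A B, MeasurableSet A → MeasurableSet B → Disjoint A B → μ (A ∪ B) = μ A + μ B)

/-- The largest measure below a finitely additive set function. -/
noncomputable def lowerMeasure : Measure E :=
  (lowerOuter μ h0).toMeasure (le_caratheodory_lowerOuter h0 hadd)

theorem lowerMeasure_le {A : Set E} (hA : MeasurableSet A) : lowerMeasure h0 hadd A ≤ μ A := by
  rw [lowerMeasure, toMeasure_apply _ _ hA]
  exact (OuterMeasure.ofFunction_le A).trans (by rw [iInf_pos hA])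

/-- A measure is countably subadditive, so it is at most the total weight of any countable cover.
This maximality is what yields invariance later. -/
theorem le_lowerMeasure {ν : Measure E} (h : ∀ A, MeasurableSet A → ν A ≤ μ A) :
    ν ≤ lowerMeasure h0 hadd := by
  refine Measure.le_iff.2 fun A hA => ?_
  rw [lowerMeasure, toMeasure_apply _ _ hA]
  exact OuterMeasure.le_ofFunction.2 (fun s => le_iInf fun hs => h s hs) A

theorem exists_cover_of_lowerMeasure_univ_lt {c : ℝ≥0∞} (h : lowerMeasure h0 hadd Set.univ < c) :
    ∃ A : ℕ → Set E, (∀ k, MeasurableSet (A k)) ∧ ⋃ k, A k = Set.univ ∧ ∑' k, μ (A k) < c := by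
  rw [lowerMeasure, toMeasure_apply _ _ MeasurableSet.univ, lowerOuter,
    OuterMeasure.ofFunction_apply] at h
  simp only [iInf_lt_iff] at h
  obtain ⟨A, hA, hlt⟩ := h
  have hm : ∀ k, MeasurableSet (A k) := by
    intro k
    by_contra hk
    refine (lt_top_of_lt hlt).ne (ENNReal.tsum_eq_top_of_eq_top ⟨k, by simp [hk]⟩)
  refine ⟨A, hm, Set.univ_subset_iff.1 hA, ?_⟩
  simpa [hm] using hlt

/-- Without countable subadditivity only finitely many sets of a cover can be removed; the uncovered
remainder stays as a separate term. -/
theorem finitelyAdditive_cover_le {μ : Set E → ℝ≥0∞}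
    (hadd : ∀ A B, MeasurableSet A → MeasurableSet B → Disjoint A B → μ (A ∪ B) = μ A + μ B)
    {A : ℕ → Set E} (hA : ∀ k, MeasurableSet (A k)) (N : ℕ) :
    μ Set.univ ≤ μ (⋂ k ∈ Finset.range N, (A k)ᶜ) + ∑ k ∈ Finset.range N, μ (A k) := by
  have hmono : ∀ A B, MeasurableSet A → MeasurableSet B → A ⊆ B → μ A ≤ μ B := by
    intro A B hA hB h
    rw [← Set.union_sdiff_cancel h, hadd _ _ hA (hB.diff hA) Set.disjoint_sdiff_right]
    exact le_self_add
  induction N with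
  | zero => simp
  | succ N ih =>
    have hB : MeasurableSet (⋂ k ∈ Finset.range N, (A k)ᶜ) :=
      Finset.measurableSet_biInter _ fun k _ => (hA k).compl
    set B := ⋂ k ∈ Finset.range N, (A k)ᶜ
    have hsucc : ⋂ k ∈ Finset.range (N + 1), (A k)ᶜ = B \ A N := by
      rw [Finset.range_add_one, Finset.set_biInter_insert, Set.inter_comm]; rfl
    rw [hsucc, Finset.sum_range_succ]
    refine ih.trans ?_
    have : μ B ≤ μ (B \ A N) + μ (A N) := by
      conv_lhs => rw [← Set.sdiff_union_inter B (A N)]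
      rw [hadd _ _ (hB.diff (hA N)) (hB.inter (hA N)) Set.disjoint_sdiff_inter]
      gcongr
      exact hmono _ _ (hB.inter (hA N)) (hA N) Set.inter_subset_right
    calc _ ≤ μ (B \ A N) + μ (A N) + ∑ k ∈ Finset.range N, μ (A k) := by gcongr
      _ = _ := by ring

end LargestMeasure

/-! ### Positive functionals on essentially bounded functions -/

/-- Measurable functions that are bounded outside a null set. -/
def EssBdd (m : Measure E) (f : E → ℝ≥0∞) : Prop :=
  Measurable f ∧ ∃ C : ℝ≥0, ∀ᵐ x ∂m, f x ≤ C

section EssBdd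

variable {m : Measure E} {f g : E → ℝ≥0∞}

theorem EssBdd.add (hf : EssBdd m f) (hg : EssBdd m g) : EssBdd m (f + g) := by
  obtain ⟨hf, C, hC⟩ := hf
  obtain ⟨hg, D, hD⟩ := hg
  refine ⟨hf.add hg, C + D, ?_⟩
  filter_upwards [hC, hD] with x h1 h2
  simpa using add_le_add h1 h2

theorem EssBdd.const_mul (c : ℝ≥0) (hf : EssBdd m f) : EssBdd m (fun x => c * f x) := by
  obtain ⟨hf, C, hC⟩ := hf
  refine ⟨hf.const_mul _, c * C, ?_⟩
  filter_upwards [hC] with x h1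
  rw [ENNReal.coe_mul]
  gcongr

theorem essBdd_of_le {C : ℝ≥0} (hf : Measurable f) (h : ∀ x, f x ≤ C) : EssBdd m f :=
  ⟨hf, C, ae_of_all _ h⟩

theorem essBdd_indicator {A : Set E} (hA : MeasurableSet A) :
    EssBdd m (A.indicator fun _ => (1 : ℝ≥0∞)) :=
  essBdd_of_le (C := 1) (measurable_const.indicator hA)
    (by intro x; by_cases h : x ∈ A <;> simp [h])

theorem essBdd_const (c : ℝ≥0) : EssBdd m fun _ => (c : ℝ≥0∞) :=
  essBdd_of_le (C := c) measurable_const fun _ => le_rfl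

theorem essBdd_simpleFunc (φ : SimpleFunc E ℝ≥0) : EssBdd m fun x => (φ x : ℝ≥0∞) := by
  obtain ⟨C, hC⟩ := φ.range.bddAbove
  refine essBdd_of_le (C := C) φ.measurable.coe_nnreal_ennreal fun x => ?_
  exact_mod_cast hC (by simp)

end EssBdd

/-- Positive linear functionals on the nonnegative essentially bounded functions. -/
structure IsPositiveFunctional (m : Measure E) (Λ : (E → ℝ≥0∞) → ℝ≥0∞) : Prop where
  mono : ∀ f g, EssBdd m f → EssBdd m g → f ≤ᵐ[m] g → Λ f ≤ Λ g
  add : ∀ f g, EssBdd m f → EssBdd m g → Λ (f + g) = Λ f + Λ g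
  const_mul : ∀ (c : ℝ≥0) f, EssBdd m f → Λ (fun x => c * f x) = c * Λ f

section Functional

variable {m : Measure E} {Λ Λ' : (E → ℝ≥0∞) → ℝ≥0∞}

theorem IsPositiveFunctional.congr (hΛ : IsPositiveFunctional m Λ) {f g : E → ℝ≥0∞}
    (hf : EssBdd m f) (hg : EssBdd m g) (h : f =ᵐ[m] g) : Λ f = Λ g :=
  le_antisymm (hΛ.mono f g hf hg h.le) (hΛ.mono g f hg hf h.symm.le)

theorem IsPositiveFunctional.zero (hΛ : IsPositiveFunctional m Λ) : Λ (fun _ => 0) = 0 := by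
  simpa using hΛ.const_mul 0 (fun _ => ((0 : ℝ≥0) : ℝ≥0∞)) (essBdd_const 0)

/-- The set function of a positive functional. -/
noncomputable def setFun (Λ : (E → ℝ≥0∞) → ℝ≥0∞) (A : Set E) : ℝ≥0∞ :=
  Λ (A.indicator fun _ => 1)

theorem IsPositiveFunctional.setFun_empty (hΛ : IsPositiveFunctional m Λ) :
    setFun Λ ∅ = 0 := by
  simpa [setFun] using hΛ.zero

theorem IsPositiveFunctional.setFun_union (hΛ : IsPositiveFunctional m Λ) (A B : Set E)
    (hA : MeasurableSet A) (hB : MeasurableSet B) (h : Disjoint A B) :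
    setFun Λ (A ∪ B) = setFun Λ A + setFun Λ B := by
  rw [setFun, Set.indicator_union_of_disjoint h]
  exact hΛ.add _ _ (essBdd_indicator hA) (essBdd_indicator hB)

theorem IsPositiveFunctional.simpleFunc_le (hΛ : IsPositiveFunctional m Λ)
    (hΛ' : IsPositiveFunctional m Λ')
    (h : ∀ A, MeasurableSet A → setFun Λ A ≤ setFun Λ' A) (φ : SimpleFunc E ℝ≥0) :
    Λ (fun x => φ x) ≤ Λ' (fun x => φ x) := by
  induction φ using SimpleFunc.induction with
  | const c hs =>
    rename_i s
    have : (fun x => ((SimpleFunc.piecewise s hs (SimpleFunc.const _ c)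
        (SimpleFunc.const _ 0) x : ℝ≥0) : ℝ≥0∞)) =
        fun x => (c : ℝ≥0∞) * s.indicator (fun _ => (1 : ℝ≥0∞)) x := by
      ext x
      by_cases hx : x ∈ s <;> simp [hx]
    rw [this, hΛ.const_mul _ _ (essBdd_indicator hs), hΛ'.const_mul _ _ (essBdd_indicator hs)]
    gcongr
    exact h s hs
  | @add f g _ ihf ihg =>
    have : (fun x => (((f + g) x : ℝ≥0) : ℝ≥0∞)) =
        (fun x => (f x : ℝ≥0∞)) + fun x => (g x : ℝ≥0∞) := by
      ext x; simp
    rw [this, hΛ.add _ _ (essBdd_simpleFunc f) (essBdd_simpleFunc g),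
      hΛ'.add _ _ (essBdd_simpleFunc f) (essBdd_simpleFunc g)]
    exact add_le_add ihf ihg

theorem isPositiveFunctional_lintegral {ν : Measure E} (hν : ν ≪ m) :
    IsPositiveFunctional m fun f => ∫⁻ x, f x ∂ν where
  mono _ _ _ _ h := lintegral_mono_ae (hν.ae_le h)
  add _ g hf _ := lintegral_add_left hf.1 g
  const_mul _ _ hf := lintegral_const_mul _ hf.1

/-- The integral is a supremum over simple functions below `f`, and `Λ` is monotone. No continuity
of `Λ` is available, so domination on sets gives only an inequality. -/
theorem IsPositiveFunctional.lintegral_le (hΛ : IsPositiveFunctional m Λ) {ν : Measure E}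
    (hν : ν ≪ m) (h : ∀ A, MeasurableSet A → ν A ≤ setFun Λ A) {f : E → ℝ≥0∞}
    (hf : EssBdd m f) : ∫⁻ x, f x ∂ν ≤ Λ f := by
  rw [lintegral_eq_nnreal]
  refine iSup₂_le fun φ hφ => ?_
  have h1 := (isPositiveFunctional_lintegral hν).simpleFunc_le hΛ (fun A hA => by
    simpa [setFun, lintegral_indicator hA] using h A hA) φ
  rw [← SimpleFunc.lintegral_eq_lintegral]
  exact h1.trans (hΛ.mono _ _ (essBdd_simpleFunc φ) hf (ae_of_all _ hφ))

/-- The inequality holds for both `f` and `C - f`, while their sum is constant and gives equality;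
hence each inequality is an equality. -/
theorem IsPositiveFunctional.lintegral_eq (hΛ : IsPositiveFunctional m Λ) {ν : Measure E}
    [IsFiniteMeasure ν] (hν : ν ≪ m) (h : ∀ A, MeasurableSet A → ν A = setFun Λ A)
    {f : E → ℝ≥0∞} (hf : EssBdd m f) : ∫⁻ x, f x ∂ν = Λ f := by
  obtain ⟨C, hC⟩ := hf.2
  set g : E → ℝ≥0∞ := fun x => C - f x
  have hg : EssBdd m g :=
    essBdd_of_le (C := C) (measurable_const.sub hf.1) fun x => tsub_le_self
  have hfg : f + g =ᵐ[m] fun _ => C := by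
    filter_upwards [hC] with x hx
    exact add_tsub_cancel_of_le hx
  have hle : ∀ {f}, EssBdd m f → ∫⁻ x, f x ∂ν ≤ Λ f :=
    fun hf => hΛ.lintegral_le hν (fun A hA => (h A hA).le) hf
  have huniv : Λ (fun _ => (C : ℝ≥0∞)) = C * ν Set.univ := by
    have := hΛ.const_mul C _ (essBdd_indicator MeasurableSet.univ)
    rw [h _ MeasurableSet.univ, setFun, ← this]
    simp
  have hsum : Λ f + Λ g = ∫⁻ x, f x ∂ν + ∫⁻ x, g x ∂ν := by
    rw [← hΛ.add f g hf hg, hΛ.congr (hf.add hg) (essBdd_const C) hfg, huniv,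
      ← lintegral_add_left hf.1]
    exact (lintegral_const _).symm.trans (lintegral_congr_ae (hν.ae_le hfg)).symm
  have hfin : ∫⁻ x, g x ∂ν ≠ ∞ := by
    refine ((lintegral_mono (fun x => tsub_le_self)).trans_lt (b := ∫⁻ _, (C : ℝ≥0∞) ∂ν) ?_).ne
    simpa using ENNReal.mul_lt_top ENNReal.coe_lt_top (measure_lt_top ν _)
  refine le_antisymm (hle hf) ?_
  have : Λ f + ∫⁻ x, g x ∂ν ≤ ∫⁻ x, f x ∂ν + ∫⁻ x, g x ∂ν := by
    rw [← hsum]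
    gcongr
    exact hle hg
  exact (ENNReal.add_le_add_iff_right hfin).1 this

end Functional

/-! ### Markov families -/

/-- Semigroups of Markov operators, indexed by positive times, acting modulo null sets on the
nonnegative essentially bounded functions. -/
structure IsMarkovFamily (m : Measure E) (T : ℝ≥0 → (E → ℝ≥0∞) → E → ℝ≥0∞) : Prop where
  measurable : ∀ t, 0 < t → ∀ f, EssBdd m f → Measurable (T t f)
  mono : ∀ t, 0 < t → ∀ f g, EssBdd m f → EssBdd m g → f ≤ᵐ[m] g → T t f ≤ᵐ[m] T t g
  add : ∀ t, 0 < t → ∀ f g, EssBdd m f → EssBdd m g → T t (f + g) =ᵐ[m] T t f + T t g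
  const_mul : ∀ t, 0 < t → ∀ (c : ℝ≥0) f, EssBdd m f →
    T t (fun x => c * f x) =ᵐ[m] fun x => c * T t f x
  one : ∀ t, 0 < t → T t (fun _ => 1) =ᵐ[m] fun _ => 1
  semigroup : ∀ s t, 0 < s → 0 < t → ∀ f, EssBdd m f → T s (T t f) =ᵐ[m] T (s + t) f
  iUnion : ∀ t, 0 < t → ∀ A : ℕ → Set E, (∀ k, MeasurableSet (A k)) →
    Pairwise (Function.onFun Disjoint A) →
    T t ((⋃ k, A k).indicator fun _ => 1) =ᵐ[m] fun x => ∑' k, T t ((A k).indicator fun _ => 1) x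
  time_measurable : ∀ f, EssBdd m f →
    AEMeasurable (fun s : ℝ => ∫⁻ x, T s.toNNReal f x ∂m) (volume.restrict (Set.Ioi 0))

/-- `m(T_t 1_A)`. -/
noncomputable def mass (m : Measure E) (T : ℝ≥0 → (E → ℝ≥0∞) → E → ℝ≥0∞) (t : ℝ≥0)
    (A : MSet E) : ℝ≥0∞ :=
  ∫⁻ x, T t (A.1.indicator fun _ => 1) x ∂m

/-- `(1/u) ∫_0^u m(T_s f) ds`. -/
noncomputable def average (m : Measure E) (T : ℝ≥0 → (E → ℝ≥0∞) → E → ℝ≥0∞) (u : ℝ)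
    (f : E → ℝ≥0∞) : ℝ≥0∞ :=
  (ENNReal.ofReal u)⁻¹ * ∫⁻ s in Set.Ioc (0 : ℝ) u, ∫⁻ x, T s.toNNReal f x ∂m

/-- The limit along a nonprincipal ultrafilter. -/
noncomputable def ultraLim (u : ℕ → ℝ≥0∞) : ℝ≥0∞ :=
  limUnder (hyperfilter ℕ : Filter ℕ) u

/-- `ℝ≥0∞` is compact, so every ultrafilter on it converges. -/
theorem tendsto_ultraLim (u : ℕ → ℝ≥0∞) :
    Tendsto u (hyperfilter ℕ) (𝓝 (ultraLim u)) :=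
  tendsto_nhds_limUnder ⟨_, ((hyperfilter ℕ).map u).le_nhds_lim⟩

/-! ### Time averages, their limit functional, and invariant measures. -/

namespace IsMarkovFamily

variable {m : Measure E} {T : ℝ≥0 → (E → ℝ≥0∞) → E → ℝ≥0∞}

theorem le_const (hT : IsMarkovFamily m T) {t : ℝ≥0} (ht : 0 < t) {f : E → ℝ≥0∞}
    (hf : EssBdd m f) {C : ℝ≥0} (hC : ∀ᵐ x ∂m, f x ≤ C) : ∀ᵐ x ∂m, T t f x ≤ C := by
  have h1 : EssBdd m fun _ : E => (1 : ℝ≥0∞) := by simpa using essBdd_const (m := m) 1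
  have h := hT.mono t ht f _ hf (h1.const_mul C)
    (by filter_upwards [hC] with x hx; simpa using hx)
  filter_upwards [h, hT.const_mul t ht C _ h1, hT.one t ht] with x h2 h3 h4
  rwa [h3, h4, mul_one] at h2

theorem essBdd (hT : IsMarkovFamily m T) {t : ℝ≥0} (ht : 0 < t) {f : E → ℝ≥0∞}
    (hf : EssBdd m f) : EssBdd m (T t f) := by
  obtain ⟨C, hC⟩ := hf.2
  exact ⟨hT.measurable t ht f hf, C, hT.le_const ht hf hC⟩

theorem isPositiveFunctional (hT : IsMarkovFamily m T) {t : ℝ≥0} (ht : 0 < t) {ν : Measure E}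
    (hν : ν ≪ m) : IsPositiveFunctional m fun f => ∫⁻ x, T t f x ∂ν where
  mono f g hf hg h := lintegral_mono_ae (hν.ae_le (hT.mono t ht f g hf hg h))
  add f g hf hg := by
    rw [lintegral_congr_ae (hν.ae_le (hT.add t ht f g hf hg))]
    exact lintegral_add_left (hT.measurable t ht f hf) _
  const_mul c f hf := by
    rw [lintegral_congr_ae (hν.ae_le (hT.const_mul t ht c f hf)),
      lintegral_const_mul _ (hT.measurable t ht f hf)]

theorem time_measurable_Ioc (hT : IsMarkovFamily m T) (u : ℝ) {f : E → ℝ≥0∞}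
    (hf : EssBdd m f) :
    AEMeasurable (fun s : ℝ => ∫⁻ x, T s.toNNReal f x ∂m) (volume.restrict (Set.Ioc 0 u)) :=
  (hT.time_measurable f hf).mono_measure (Measure.restrict_mono Set.Ioc_subset_Ioi_self le_rfl)

theorem isPositiveFunctional_average (hT : IsMarkovFamily m T) (u : ℝ) :
    IsPositiveFunctional m (average m T u) where
  mono f g hf hg h := by
    refine mul_le_mul_right (setLIntegral_mono' measurableSet_Ioc fun s hs => ?_) _
    exact (hT.isPositiveFunctional (Real.toNNReal_pos.2 hs.1) Measure.AbsolutelyContinuous.rfl).mono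
      f g hf hg h
  add f g hf hg := by
    rw [average, average, average, ← mul_add,
      ← lintegral_add_left' (hT.time_measurable_Ioc u hf)]
    congr 1
    refine setLIntegral_congr_fun measurableSet_Ioc fun s hs => ?_
    exact (hT.isPositiveFunctional (Real.toNNReal_pos.2 hs.1) Measure.AbsolutelyContinuous.rfl).add
      f g hf hg
  const_mul c f hf := by
    rw [average, average, mul_left_comm, ← lintegral_const_mul'' _ (hT.time_measurable_Ioc u hf)]
    congr 1
    refine setLIntegral_congr_fun measurableSet_Ioc fun s hs => ?_
    exact (hT.isPositiveFunctional (Real.toNNReal_pos.2 hs.1)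
      Measure.AbsolutelyContinuous.rfl).const_mul c f hf

theorem average_one (hT : IsMarkovFamily m T) {u : ℝ} (hu : 0 < u) :
    average m T u (fun _ => 1) = m Set.univ := by
  have : ∫⁻ s in Set.Ioc (0 : ℝ) u, ∫⁻ x, T s.toNNReal (fun _ => 1) x ∂m =
      ∫⁻ s in Set.Ioc (0 : ℝ) u, m Set.univ := by
    refine setLIntegral_congr_fun measurableSet_Ioc fun s hs => ?_
    simp [lintegral_congr_ae (hT.one _ (Real.toNNReal_pos.2 hs.1))]
  rw [average, this, setLIntegral_const, Real.volume_Ioc, sub_zero, mul_comm, mul_assoc,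
    ENNReal.mul_inv_cancel (by simpa using hu) (by simp), mul_one]

/-- By the semigroup law, applying `T_t` moves the window `(0, u]` to `(t, u + t]`. The only new
part is `(u, u + t]`, of length `t`, where the integrand is at most `C m(E)`. -/
theorem average_apply_le (hT : IsMarkovFamily m T) (u : ℝ) {t : ℝ≥0} (ht : 0 < t)
    {f : E → ℝ≥0∞} (hf : EssBdd m f) {C : ℝ≥0} (hC : ∀ᵐ x ∂m, f x ≤ C) :
    average m T u (T t f) ≤ average m T u f + (ENNReal.ofReal u)⁻¹ * (C * m Set.univ * t) := by
  rw [average, average, ← mul_add]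
  refine mul_le_mul_right ?_ _
  set G : ℝ → ℝ≥0∞ := fun s => ∫⁻ x, T s.toNNReal f x ∂m with hG
  have h1 : ∫⁻ s in Set.Ioc (0 : ℝ) u, ∫⁻ x, T s.toNNReal (T t f) x ∂m =
      ∫⁻ s in Set.Ioc (0 : ℝ) u, G (s + t) := by
    refine setLIntegral_congr_fun measurableSet_Ioc fun s hs => ?_
    rw [hG]
    simp only
    rw [Real.toNNReal_add hs.1.le t.coe_nonneg, Real.toNNReal_coe]
    exact lintegral_congr_ae (hT.semigroup _ t (Real.toNNReal_pos.2 hs.1) ht f hf)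
  have h2 : ∫⁻ s in Set.Ioc (0 : ℝ) u, G (s + t) = ∫⁻ s in Set.Ioc (t : ℝ) (u + t), G s := by
    rw [← (measurePreserving_add_right volume (t : ℝ)).setLIntegral_comp_preimage_emb
      (measurableEmbedding_addRight (t : ℝ)) G]
    simp
  have h3 : Set.Ioc (t : ℝ) (u + t) ⊆ Set.Ioc 0 u ∪ Set.Ioc u (u + t) := by
    intro s hs
    rcases le_or_gt s u with h | h
    · exact Or.inl ⟨(NNReal.coe_pos.2 ht).trans hs.1, h⟩
    · exact Or.inr ⟨h, hs.2⟩
  rw [h1, h2]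
  -- For `u ≤ 0` the interval `(u, u + t]` may contain nonpositive times, where no bound is known;
  -- but then the shifted window is empty.
  rcases le_or_gt u 0 with hu | hu
  · have : Set.Ioc (t : ℝ) (u + t) = ∅ := Set.Ioc_eq_empty (by simpa using hu)
    simp [this]
  refine (lintegral_mono_set h3).trans ((lintegral_union_le _ _ _).trans (add_le_add_right ?_ _))
  refine (setLIntegral_mono' (g := fun _ => (C : ℝ≥0∞) * m Set.univ) measurableSet_Ioc
    fun s hs => ?_).trans ?_
  · refine (lintegral_mono_ae (hT.le_const (Real.toNNReal_pos.2 (hu.trans hs.1)) hf hC)).trans ?_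
    simp
  · simp

/-- The ultrafilter limit of the time averages. -/
noncomputable def limitFunctional (m : Measure E) (T : ℝ≥0 → (E → ℝ≥0∞) → E → ℝ≥0∞)
    (t : ℕ → ℝ) (f : E → ℝ≥0∞) : ℝ≥0∞ :=
  ultraLim fun n => average m T (t n) f

theorem isPositiveFunctional_limitFunctional (hT : IsMarkovFamily m T) (t : ℕ → ℝ) :
    IsPositiveFunctional m (limitFunctional m T t) where
  mono f g hf hg h := le_of_tendsto_of_tendsto' (tendsto_ultraLim _) (tendsto_ultraLim _)
    fun n => (hT.isPositiveFunctional_average (t n)).mono f g hf hg h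
  add f g hf hg := by
    refine tendsto_nhds_unique (tendsto_ultraLim _) ?_
    simp_rw [fun n => (hT.isPositiveFunctional_average (t n)).add f g hf hg]
    exact (tendsto_ultraLim _).add (tendsto_ultraLim _)
  const_mul c f hf := by
    refine tendsto_nhds_unique (tendsto_ultraLim _) ?_
    simp_rw [fun n => (hT.isPositiveFunctional_average (t n)).const_mul c f hf]
    exact ENNReal.Tendsto.const_mul (tendsto_ultraLim _) (Or.inr ENNReal.coe_ne_top)

theorem limitFunctional_one (hT : IsMarkovFamily m T) {t : ℕ → ℝ}
    (ht : IncreasesToInfinity t) : limitFunctional m T t (fun _ => 1) = m Set.univ := by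
  refine tendsto_nhds_unique (tendsto_ultraLim _) ?_
  simp_rw [fun n => hT.average_one (ht.pos n)]
  exact tendsto_const_nhds

/-- The boundary error is `C m(E) s / t_n`, which vanishes in the limit. One inequality suffices,
since conservation of mass turns it into equality for `ν`. -/
theorem limitFunctional_apply_le (hT : IsMarkovFamily m T) [IsFiniteMeasure m] {t : ℕ → ℝ}
    (ht : IncreasesToInfinity t) {s : ℝ≥0} (hs : 0 < s) {f : E → ℝ≥0∞} (hf : EssBdd m f) :
    limitFunctional m T t (T s f) ≤ limitFunctional m T t f := by
  obtain ⟨C, hC⟩ := hf.2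
  have hzero : Tendsto (fun n => (ENNReal.ofReal (t n))⁻¹ * (C * m Set.univ * s))
      (hyperfilter ℕ) (𝓝 0) := by
    have h1 : Tendsto (fun n => (ENNReal.ofReal (t n))⁻¹) atTop (𝓝 0) := by
      simpa using (ENNReal.tendsto_ofReal_atTop.comp ht.tendsto).inv
    have h2 := ENNReal.Tendsto.mul_const (b := C * m Set.univ * s) h1 (Or.inr
      (ENNReal.mul_ne_top (ENNReal.mul_ne_top ENNReal.coe_ne_top (measure_ne_top _ _))
        ENNReal.coe_ne_top))
    rw [zero_mul] at h2
    exact h2.mono_left Nat.hyperfilter_le_atTop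
  have h := (tendsto_ultraLim fun n => average m T (t n) f).add hzero
  rw [add_zero] at h
  exact le_of_tendsto_of_tendsto' (tendsto_ultraLim _) h
    fun n => hT.average_apply_le (t n) hs hf hC

/-- The measure `A ↦ ∫ T_t 1_A dν`. -/
theorem exists_image_measure (hT : IsMarkovFamily m T) {ν : Measure E} (hν : ν ≪ m) {s : ℝ≥0}
    (hs : 0 < s) : ∃ ν' : Measure E, ∀ A, MeasurableSet A →
      ν' A = ∫⁻ x, T s (A.indicator fun _ => 1) x ∂ν := by
  refine ⟨Measure.ofMeasurable (fun A _ => ∫⁻ x, T s (A.indicator fun _ => 1) x ∂ν) ?_ ?_,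
    fun A hA => Measure.ofMeasurable_apply A hA⟩
  · simpa using (hT.isPositiveFunctional hs hν).zero
  · intro A hA hd
    rw [lintegral_congr_ae (hν.ae_le (hT.iUnion s hs A hA hd)), lintegral_tsum
      fun k => (hT.measurable s hs _ (essBdd_indicator (hA k))).aemeasurable]

theorem exists_invariant (hT : IsMarkovFamily m T) [IsFiniteMeasure m] {t : ℕ → ℝ}
    (ht : IncreasesToInfinity t) (hindex : index m (mass m T) t < m Set.univ) :
    ∃ ν : Measure E, IsFiniteMeasure ν ∧ ν ≠ 0 ∧ ν ≪ m ∧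
      ∀ s, 0 < s → ∀ f, EssBdd m f → ∫⁻ x, T s f x ∂ν = ∫⁻ x, f x ∂ν := by
  have hΛ := hT.isPositiveFunctional_limitFunctional t
  set Λ := limitFunctional m T t
  have huniv : setFun Λ Set.univ = m Set.univ := by
    simpa [setFun] using hT.limitFunctional_one ht
  set ν := lowerMeasure hΛ.setFun_empty hΛ.setFun_union with hν_def
  have hle : ∀ A, MeasurableSet A → ν A ≤ setFun Λ A := fun A hA => lowerMeasure_le _ _ hA
  have hfin : IsFiniteMeasure ν :=
    ⟨(hle _ MeasurableSet.univ).trans_lt (huniv ▸ measure_lt_top m _)⟩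
  have hac : ν ≪ m := by
    refine Measure.AbsolutelyContinuous.mk fun A hA h0 => le_antisymm ((hle A hA).trans ?_) zero_le
    rw [← hΛ.zero]
    refine hΛ.mono _ _ (essBdd_indicator hA) (by simpa using essBdd_const (m := m) 0) ?_
    filter_upwards [measure_eq_zero_iff_ae_notMem.1 h0] with x hx
    simp [hx]
  refine ⟨ν, hfin, ?_, hac, fun s hs f hf => ?_⟩
  · intro h0
    obtain ⟨ε, hε, hεlt⟩ : ∃ ε : ℝ≥0∞, 0 < ε ∧ indexAt m (mass m T) t ε < m Set.univ := by
      have h1 := (tendsto_indexAt m (mass m T) t).eventually (gt_mem_nhds hindex)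
      obtain ⟨ε, h, h'⟩ := (h1.and self_mem_nhdsWithin).exists
      exact ⟨ε, h', h⟩
    -- The threshold is the gap left by the index: the cover weighs less than `m(E) - indexAt ε`.
    obtain ⟨A, hA, hcover, hsum⟩ := exists_cover_of_lowerMeasure_univ_lt hΛ.setFun_empty
      hΛ.setFun_union (c := m Set.univ - indexAt m (mass m T) t ε)
      (by rw [← hν_def, h0]; simpa using hεlt)
    set B : ℕ → Set E := fun N => ⋂ k ∈ Finset.range N, (A k)ᶜ
    have hB : ∀ N, MeasurableSet (B N) :=
      fun N => Finset.measurableSet_biInter _ fun k _ => (hA k).compl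
    have hBanti : Antitone B := fun M N h =>
      Set.biInter_subset_biInter_left (Finset.range_subset_range.2 h)
    have hBempty : ⋂ N, B N = ∅ := by
      refine Set.eq_empty_of_forall_notMem fun x hx => ?_
      obtain ⟨k, hk⟩ := Set.mem_iUnion.1 (hcover ▸ Set.mem_univ x : x ∈ ⋃ k, A k)
      have := Set.mem_iInter.1 hx (k + 1)
      exact Set.mem_iInter₂.1 this k (by simp) hk
    have hlim : Tendsto (fun N => m (B N)) atTop (𝓝 0) := by
      have := tendsto_measure_iInter_atTop (μ := m) (fun N => (hB N).nullMeasurableSet) hBanti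
        ⟨0, measure_ne_top _ _⟩
      rwa [hBempty, measure_empty] at this
    obtain ⟨N, hN⟩ := (hlim.eventually (gt_mem_nhds hε)).exists
    have hBle : setFun Λ (B N) ≤ indexAt m (mass m T) t ε := by
      refine le_of_tendsto' (tendsto_ultraLim _) fun n => ?_
      -- The average of `1_{B N}` unfolds to a `timeAverage` of `mass m T`, one of the terms in the
      -- supremum `indexAt`.
      exact le_iSup₂_of_le (⟨B N, hB N⟩ : MSet E) hN.le
        (le_iSup (fun n => timeAverage (mass m T) (t n) ⟨B N, hB N⟩) n)
    have hlt : setFun Λ Set.univ < m Set.univ := by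
      calc setFun Λ Set.univ
          ≤ setFun Λ (B N) + ∑ k ∈ Finset.range N, setFun Λ (A k) :=
            finitelyAdditive_cover_le hΛ.setFun_union hA N
        _ ≤ indexAt m (mass m T) t ε + ∑' k, setFun Λ (A k) :=
            add_le_add hBle (ENNReal.sum_le_tsum _)
        _ < indexAt m (mass m T) t ε + (m Set.univ - indexAt m (mass m T) t ε) :=
            ENNReal.add_lt_add_left (hεlt.trans (measure_lt_top m _)).ne hsum
        _ = m Set.univ := add_tsub_cancel_of_le hεlt.le
    exact hlt.ne huniv
  · obtain ⟨ν', hν'⟩ := hT.exists_image_measure hac hs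
    have hle' : ν' ≤ ν := by
      refine le_lowerMeasure _ _ fun A hA => ?_
      rw [hν' A hA]
      exact (hΛ.lintegral_le hac hle (hT.essBdd hs (essBdd_indicator hA))).trans
        (hT.limitFunctional_apply_le ht hs (essBdd_indicator hA))
    have heq : ν' = ν := by
      have : IsFiniteMeasure ν' := isFiniteMeasure_of_le ν hle'
      refine Measure.eq_of_le_of_measure_univ_eq hle' ?_
      rw [hν' _ MeasurableSet.univ, Set.indicator_univ, lintegral_congr_ae (hac.ae_le (hT.one s hs))]
      simp
    -- Equality on sets extends to essentially bounded functions, now with `f ↦ ∫ T_s f dν` as the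
    -- functional.
    refine ((hT.isPositiveFunctional hs hac).lintegral_eq hac (fun A hA => ?_) hf).symm
    rw [setFun, ← hν' A hA, heq]

/-- Off `B = {g ≥ c}` one uses `T_t 1_A ≤ 1`; on `B`, `1 ≤ g / c` and invariance of `ν`. Thus `δ =
m(Bᶜ) / m(E)`, which is below `1` as `m(B) > 0`, and `φ = ν / c`. -/
theorem isAlmostInvariant (hT : IsMarkovFamily m T) [IsFiniteMeasure m] (hm : m ≠ 0)
    {ν : Measure E} [IsFiniteMeasure ν] (hν : ν ≠ 0) (hac : ν ≪ m)
    (hinv : ∀ s, 0 < s → ∀ A, MeasurableSet A → ∫⁻ x, T s (A.indicator fun _ => 1) x ∂ν = ν A) :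
    IsAlmostInvariant m (mass m T) := by
  have hm0 : m Set.univ ≠ 0 := by simpa using hm
  set g := ν.rnDeriv m
  have hg : m.withDensity g = ν := Measure.withDensity_rnDeriv_eq ν m hac
  have hgm : Measurable g := Measure.measurable_rnDeriv ν m
  -- Otherwise `g < 1 / (n + 1)` almost everywhere for every `n`, so `g = 0` and `ν = 0`.
  obtain ⟨c, hc, hB⟩ : ∃ c : ℝ≥0, 0 < c ∧ m {x | c ≤ g x} ≠ 0 := by
    by_contra! h
    apply hν
    have h0 : g =ᵐ[m] 0 := by
      have : ∀ n : ℕ, ∀ᵐ x ∂m, g x < ((1 / (n + 1 : ℝ≥0) : ℝ≥0) : ℝ≥0∞) := fun n => by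
        filter_upwards [measure_eq_zero_iff_ae_notMem.1 (h (1 / (n + 1 : ℝ≥0)) (by positivity))]
          with x hx
        simpa using hx
      filter_upwards [ae_all_iff.2 this] with x hx
      by_contra hne
      obtain ⟨r, hr0, hr⟩ := ENNReal.lt_iff_exists_nnreal_btwn.1 (pos_iff_ne_zero.2 hne)
      obtain ⟨n, hn⟩ := exists_nat_one_div_lt (K := ℝ≥0) (ε := r) (by simpa using hr0)
      exact absurd (hx n) (not_lt.2 ((ENNReal.coe_le_coe.2 hn.le).trans hr.le))
    rw [← hg, withDensity_congr_ae h0, withDensity_zero]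
  set B := {x | (c : ℝ≥0∞) ≤ g x}
  have hBm : MeasurableSet B := measurableSet_le measurable_const hgm
  have hδ : m Bᶜ / m Set.univ < 1 := by
    refine ENNReal.div_lt_of_lt_mul' ?_
    rw [mul_one, measure_compl hBm (measure_ne_top _ _)]
    exact ENNReal.sub_lt_self (measure_ne_top _ _) hm0 hB
  refine ⟨(m Bᶜ / m Set.univ).toNNReal, ?_, fun A => c⁻¹ * (ν A.1).toNNReal, ?_, ?_⟩
  · rw [← ENNReal.coe_lt_coe, ENNReal.coe_toNNReal hδ.ne_top]
    exact_mod_cast hδ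
  · intro ε hε
    have hfin : ∫⁻ x, g x ∂m ≠ ∞ := by
      rw [← setLIntegral_univ, ← withDensity_apply _ MeasurableSet.univ, hg]
      exact measure_ne_top _ _
    obtain ⟨δ, hδ, h⟩ := exists_pos_setLIntegral_lt_of_measure_lt hfin
      (ε := (c * ε : ℝ≥0)) (by simpa using ⟨hc.ne', hε.ne'⟩)
    obtain ⟨η, hη0, hη⟩ := ENNReal.lt_iff_exists_nnreal_btwn.1 hδ
    refine ⟨η, by simpa using hη0, fun A hA => ?_⟩
    have h2 := h A.1 (hA.trans_lt hη)
    rw [← withDensity_apply _ A.2, hg] at h2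
    rw [inv_mul_le_iff₀ hc, ← ENNReal.coe_le_coe, ENNReal.coe_toNNReal (measure_ne_top _ _)]
    exact h2.le
  · intro t ht A
    have hF := hT.measurable t ht _ (essBdd_indicator A.2)
    have hF1 : ∀ᵐ x ∂m, T t (A.1.indicator fun _ => 1) x ≤ (1 : ℝ≥0) :=
      hT.le_const ht (essBdd_indicator A.2)
        (ae_of_all _ fun x => by by_cases h : x ∈ A.1 <;> simp [h])
    rw [mass]
    set F := T t (A.1.indicator fun _ => 1) with hF_def
    rw [← lintegral_add_compl _ hBm, add_comm]
    refine add_le_add ?_ ?_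
    · rw [ENNReal.coe_toNNReal hδ.ne_top, ENNReal.div_mul_cancel hm0 (measure_ne_top _ _)]
      refine (lintegral_mono_ae (ae_restrict_of_ae hF1)).trans ?_
      simp
    · rw [ENNReal.coe_mul, ENNReal.coe_toNNReal (measure_ne_top _ _), ← hinv t ht A.1 A.2,
        ENNReal.coe_inv hc.ne', ← hF_def, ← hg, lintegral_withDensity_eq_lintegral_mul _ hgm hF,
        ← lintegral_const_mul _ (hgm.mul hF)]
      refine (setLIntegral_mono' (g := fun x => (c : ℝ≥0∞)⁻¹ * (g * F) x) hBm
        fun x hx => ?_).trans (setLIntegral_le_lintegral _ _)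
      rw [Pi.mul_apply, ← mul_assoc]
      have h1 : 1 ≤ (c : ℝ≥0∞)⁻¹ * g x := by
        rw [← ENNReal.inv_mul_cancel (a := (c : ℝ≥0∞)) (by simpa using hc.ne') (by simp)]
        exact mul_le_mul_right hx _
      calc F x = 1 * F x := (one_mul _).symm
        _ ≤ _ := mul_le_mul_left h1 _

end IsMarkovFamily

/-! ### From almost invariance to the index, and the abstract equivalence. -/

theorem IsAlmostInvariant.isMeanAlmostInvariant {m : Measure E} {q : ℝ≥0 → MSet E → ℝ≥0∞}
    (h : IsAlmostInvariant m q) {t : ℕ → ℝ} (ht : IncreasesToInfinity t) :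
    IsMeanAlmostInvariant m q t := by
  obtain ⟨δ, hδ, φ, hφ, h⟩ := h
  refine ⟨δ, hδ, φ, hφ, fun n A => ?_⟩
  have h0 : ENNReal.ofReal (t n) ≠ 0 := by simpa using ht.pos n
  calc timeAverage q (t n) A
      ≤ (ENNReal.ofReal (t n))⁻¹ * ∫⁻ _ in Set.Ioc (0 : ℝ) (t n), (δ * m Set.univ + φ A) := by
        refine mul_le_mul_right (setLIntegral_mono' measurableSet_Ioc fun s hs => ?_) _
        exact h _ (Real.toNNReal_pos.2 hs.1) A
    _ = δ * m Set.univ + φ A := by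
        rw [setLIntegral_const, Real.volume_Ioc, sub_zero, mul_comm, mul_assoc,
          ENNReal.mul_inv_cancel h0 (by simp), mul_one]

theorem IsMeanAlmostInvariant.index_lt {m : Measure E} [IsFiniteMeasure m] (hm : m ≠ 0)
    {q : ℝ≥0 → MSet E → ℝ≥0∞} {t : ℕ → ℝ} (h : IsMeanAlmostInvariant m q t) :
    index m q t < m Set.univ := by
  obtain ⟨δ, hδ, φ, hφ, h⟩ := h
  have hm0 : m Set.univ ≠ 0 := by simpa using hm
  have hle : index m q t ≤ δ * m Set.univ := by
    refine ENNReal.le_of_forall_pos_le_add fun ε hε _ => ?_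
    obtain ⟨η, hη, hA⟩ := hφ ε hε
    refine le_of_tendsto (tendsto_indexAt m q t) ?_
    have : Set.Ioo (0 : ℝ≥0∞) η ∈ 𝓝[>] (0 : ℝ≥0∞) :=
      Ioo_mem_nhdsGT (by simpa using hη)
    filter_upwards [this] with r hr
    refine iSup₂_le fun A hAr => iSup_le fun n => (h n A).trans ?_
    gcongr
    exact hA A (hAr.trans hr.2.le)
  refine hle.trans_lt ?_
  calc (δ : ℝ≥0∞) * m Set.univ < 1 * m Set.univ :=
        ENNReal.mul_lt_mul_left hm0 (measure_ne_top _ _) (by exact_mod_cast hδ)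
    _ = m Set.univ := one_mul _

theorem exists_increasesToInfinity : ∃ t : ℕ → ℝ, IncreasesToInfinity t :=
  ⟨fun n => n + 1, fun n => by positivity, fun a b h => by simpa using h,
    tendsto_atTop_add_const_right _ _ tendsto_natCast_atTop_atTop⟩

/-- The equivalence, for an invariance property that implies invariance on sets and follows from
invariance on essentially bounded functions. -/
theorem IsMarkovFamily.tfae {m : Measure E} [IsFiniteMeasure m] (hm : m ≠ 0)
    {T : ℝ≥0 → (E → ℝ≥0∞) → E → ℝ≥0∞} (hT : IsMarkovFamily m T) {Inv : Measure E → Prop}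
    (hset : ∀ ν : Measure E, IsFiniteMeasure ν → ν ≪ m → Inv ν →
      ∀ s, 0 < s → ∀ A, MeasurableSet A → ∫⁻ x, T s (A.indicator fun _ => 1) x ∂ν = ν A)
    (hfun : ∀ ν : Measure E, IsFiniteMeasure ν → ν ≪ m →
      (∀ s, 0 < s → ∀ f, EssBdd m f → ∫⁻ x, T s f x ∂ν = ∫⁻ x, f x ∂ν) → Inv ν) :
    List.TFAE [
      ∃ ν : Measure E, IsFiniteMeasure ν ∧ ν ≠ 0 ∧ ν ≪ m ∧ Inv ν,
      IsAlmostInvariant m (mass m T),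
      ∀ t : ℕ → ℝ, IncreasesToInfinity t → IsMeanAlmostInvariant m (mass m T) t,
      ∀ t : ℕ → ℝ, IncreasesToInfinity t → index m (mass m T) t < m Set.univ,
      ∃ t : ℕ → ℝ, IncreasesToInfinity t ∧ index m (mass m T) t < m Set.univ] := by
  tfae_have 1 → 2 := fun ⟨ν, hfin, h0, hac, h⟩ =>
    hT.isAlmostInvariant hm h0 hac (hset ν hfin hac h)
  tfae_have 2 → 3 := fun h t ht => h.isMeanAlmostInvariant ht
  tfae_have 3 → 4 := fun h t ht => (h t ht).index_lt hm
  tfae_have 4 → 5 := fun h =>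
    exists_increasesToInfinity.imp fun t ht => ⟨ht, h t ht⟩
  tfae_have 5 → 1 := fun ⟨t, ht, h⟩ => by
    obtain ⟨ν, hfin, h0, hac, hinv⟩ := hT.exists_invariant ht h
    exact ⟨ν, hfin, h0, hac, hfun ν hfin hac hinv⟩
  tfae_finish

/-! ### Transition functions -/

/-- The operators of a family of kernels. -/
noncomputable def kernelOp (P : ℝ≥0 → Kernel E E) (t : ℝ≥0) (f : E → ℝ≥0∞) (x : E) : ℝ≥0∞ :=
  ∫⁻ y, f y ∂(P t x)

theorem isMarkovFamily_kernelOp {m : Measure E} [IsFiniteMeasure m] {P : ℝ≥0 → Kernel E E}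
    (hP : IsMeasurableMarkovianTransition P) (hm : IsAuxiliary m P) :
    IsMarkovFamily m (kernelOp P) where
  measurable t _ f hf := hf.1.lintegral_kernel
  mono t ht f g hf hg h := by
    -- Only here is the auxiliary condition needed: the null set where `f ≤ g` fails is not charged
    -- by `P_t(x, ·)` for almost every `x`.
    have hN : MeasurableSet {x | g x < f x} := measurableSet_lt hg.1 hf.1
    have h0 : m {x | g x < f x} = 0 := by
      simpa [EventuallyLE, ae_iff] using h
    have h1 := hm t ht ({x | g x < f x}.indicator 1) (measurable_one.indicator hN)
      (by rwa [lintegral_indicator_one hN])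
    rw [lintegral_eq_zero_iff (measurable_one.indicator hN).lintegral_kernel] at h1
    filter_upwards [h1] with x hx
    rw [Pi.zero_apply, lintegral_indicator_one hN, measure_eq_zero_iff_ae_notMem] at hx
    exact lintegral_mono_ae (hx.mono fun y hy => not_lt.1 hy)
  add t _ f g hf _ := ae_of_all _ fun x => lintegral_add_left hf.1 _
  const_mul t _ c f hf := ae_of_all _ fun x => lintegral_const_mul _ hf.1
  one t _ := ae_of_all _ fun x => by
    have := hP.markov t
    simp [kernelOp]
  semigroup s t _ _ f hf := ae_of_all _ fun x => by
    rw [add_comm]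
    exact hP.add t s f hf.1 x
  iUnion t _ A hA hd := ae_of_all _ fun x => by
    have h : ∀ B, MeasurableSet B → kernelOp P t (B.indicator fun _ => 1) x = P t x B :=
      fun B hB => lintegral_indicator_one hB
    rw [h _ (MeasurableSet.iUnion hA), measure_iUnion hd hA]
    simp_rw [h _ (hA _)]
  time_measurable f hf :=
    ((hP.measurable f hf.1).lintegral_prod_right'.comp measurable_real_toNNReal).aemeasurable

theorem massKernel_eq_mass (m : Measure E) (P : ℝ≥0 → Kernel E E) :
    massKernel m P = mass m (kernelOp P) := by
  ext t A
  exact lintegral_congr fun x => (lintegral_indicator_one A.2).symm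

theorem IsInvariantKernel.lintegral_kernelOp_indicator {P : ℝ≥0 → Kernel E E}
    (hP : IsMeasurableMarkovianTransition P) {ν : Measure E} [IsFiniteMeasure ν]
    (h : IsInvariantKernel P ν) {t : ℝ≥0} (ht : 0 < t) {A : Set E} (hA : MeasurableSet A) :
    ∫⁻ x, kernelOp P t (A.indicator fun _ => 1) x ∂ν = ν A := by
  have := hP.markov t
  have h1 := h t ht (A.indicator 1) (measurable_one.indicator hA) 1
    (by intro x; by_cases h : x ∈ A <;> simp [h])
  simp only [integral_indicator_one hA] at h1
  have h2 : ∀ x, kernelOp P t (A.indicator fun _ => 1) x = P t x A :=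
    fun x => lintegral_indicator_one hA
  simp_rw [h2]
  have h3 : ∫⁻ x, P t x A ∂ν ≠ ∞ := by
    refine ((lintegral_mono fun x => prob_le_one).trans_lt (b := ∫⁻ _, 1 ∂ν) ?_).ne
    simp
  have hmeas : Measurable fun x => P t x A := Kernel.measurable_coe _ hA
  rw [← ENNReal.toReal_eq_toReal_iff' h3 (measure_ne_top _ _),
    ← integral_toReal hmeas.aemeasurable (ae_of_all _ fun x => measure_lt_top _ _)]
  exact h1

theorem isInvariantKernel_of_lintegral {m : Measure E} {P : ℝ≥0 → Kernel E E} {ν : Measure E}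
    [IsFiniteMeasure ν]
    (h : ∀ s, 0 < s → ∀ f, EssBdd m f → ∫⁻ x, kernelOp P s f x ∂ν = ∫⁻ x, f x ∂ν) :
    IsInvariantKernel P ν := by
  intro t ht f hf C hC
  have hbind : ν.bind (P t) = ν := by
    ext A hA
    rw [Measure.bind_apply hA (P t).aemeasurable]
    have := h t ht _ (essBdd_indicator hA)
    calc ∫⁻ x, P t x A ∂ν = ∫⁻ x, kernelOp P t (A.indicator fun _ => 1) x ∂ν :=
          lintegral_congr fun x => (lintegral_indicator_one hA).symm
      _ = ν A := this.trans (lintegral_indicator_one hA)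
  have hint : Integrable f (ν.bind (P t)) := by
    rw [hbind]
    exact Integrable.of_bound hf.aestronglyMeasurable C (ae_of_all _ hC)
  -- Viewing `ν` as a constant kernel on a point turns the iterated integral into an integral
  -- against a composition of kernels.
  have hcomp : (P t ∘ₖ Kernel.const Unit ν) () = ν.bind (P t) := by
    rw [Kernel.comp_apply, Kernel.const_apply]
  rw [← hcomp] at hint
  have h1 := ProbabilityTheory.Kernel.integral_comp hint
  rw [hcomp, hbind, Kernel.const_apply] at h1
  exact h1.symm

/-! ### Positive operators on Banach lattices -/

/-- A positive linear map between Banach lattices is bounded. -/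
theorem exists_bound_of_positive {F G : Type*} [NormedAddCommGroup F] [Lattice F] [HasSolidNorm F]
    [IsOrderedAddMonoid F] [NormedSpace ℝ F] [PosSMulMono ℝ F] [CompleteSpace F]
    [NormedAddCommGroup G] [Lattice G] [HasSolidNorm G] [IsOrderedAddMonoid G] [NormedSpace ℝ G]
    (T : F →ₗ[ℝ] G) (hT : ∀ f, 0 ≤ f → 0 ≤ T f) : ∃ C, ∀ f, ‖T f‖ ≤ C * ‖f‖ := by
  have hmono : ∀ f g, f ≤ g → T f ≤ T g := fun f g h => by
    have := hT (g - f) (sub_nonneg.2 h)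
    rwa [map_sub, sub_nonneg] at this
  have habs : ∀ f, ‖T f‖ ≤ ‖T |f|‖ := fun f => by
    refine norm_le_norm_of_abs_le_abs ?_
    rw [abs_of_nonneg (hT _ (abs_nonneg f))]
    refine abs_le'.2 ⟨hmono _ _ (le_abs_self f), ?_⟩
    rw [← map_neg]
    exact hmono _ _ (neg_le_abs f)
  by_contra! hunb
  -- The factor `n * 2 ^ n` makes the `g n` summable while `‖T (g n)‖ ≥ n`. Their sum dominates
  -- every `g n`, so its image would have norm at least every `n`.
  have key : ∀ n : ℕ, ∃ g : F, 0 ≤ g ∧ ‖g‖ ≤ (1 / 2) ^ n ∧ (n : ℝ) ≤ ‖T g‖ := fun n => by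
    obtain ⟨f, hf⟩ := hunb (n * 2 ^ n)
    have hf0 : 0 < ‖f‖ := by
      refine norm_pos_iff.2 ?_
      rintro rfl
      simp at hf
    have hc : (0 : ℝ) ≤ (1 / 2) ^ n / ‖f‖ := by positivity
    refine ⟨((1 / 2) ^ n / ‖f‖) • |f|, smul_nonneg hc (abs_nonneg f), ?_, ?_⟩
    · rw [norm_smul, Real.norm_of_nonneg hc, norm_abs_eq_norm, div_mul_cancel₀ _ hf0.ne']
    · rw [map_smul, norm_smul, Real.norm_of_nonneg hc, div_mul_eq_mul_div, le_div_iff₀ hf0]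
      calc (n : ℝ) * ‖f‖ = (1 / 2) ^ n * (n * 2 ^ n * ‖f‖) := by
            rw [one_div, inv_pow]; field_simp
        _ ≤ (1 / 2) ^ n * ‖T |f|‖ := by gcongr; exact hf.le.trans (habs f)
  choose g hg0 hg1 hg2 using key
  have hsum : Summable g := Summable.of_norm_bounded (g := fun n : ℕ => (1 / 2 : ℝ) ^ n)
    summable_geometric_two hg1
  obtain ⟨n, hn⟩ := exists_nat_gt ‖T (∑' k, g k)‖
  refine absurd ((hg2 n).trans ?_) (not_le.2 hn)
  refine norm_le_norm_of_abs_le_abs ?_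
  have hle : g n ≤ ∑' k, g k := hsum.le_tsum n fun k _ => hg0 k
  rw [abs_of_nonneg (hT _ (hg0 n)), abs_of_nonneg (hT _ ((hg0 n).trans hle))]
  exact hmono _ _ hle

/-! ### Operators on `L^p` -/

section Lp

variable {p : ℝ≥0∞} {m : Measure E}

theorem EssBdd.memLp [IsFiniteMeasure m] {f : E → ℝ≥0∞} (hf : EssBdd m f) :
    MemLp (fun x => (f x).toReal) p m := by
  obtain ⟨hf, C, hC⟩ := hf
  refine MemLp.of_bound hf.ennreal_toReal.aestronglyMeasurable C ?_
  filter_upwards [hC] with x hx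
  rw [Real.norm_of_nonneg ENNReal.toReal_nonneg]
  exact ENNReal.toReal_le_coe_of_le_coe hx

theorem EssBdd.ne_top {f : E → ℝ≥0∞} (hf : EssBdd m f) : ∀ᵐ x ∂m, f x ≠ ∞ := by
  obtain ⟨_, C, hC⟩ := hf
  exact hC.mono fun x hx => (hx.trans_lt ENNReal.coe_lt_top).ne

open scoped Classical in
/-- The class in `L^p(m)` of a nonnegative essentially bounded function. -/
noncomputable def lpClass (p : ℝ≥0∞) (m : Measure E) (f : E → ℝ≥0∞) : Lp ℝ p m :=
  if h : MemLp (fun x => (f x).toReal) p m then h.toLp else 0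

theorem coeFn_lpClass [IsFiniteMeasure m] {f : E → ℝ≥0∞} (hf : EssBdd m f) :
    lpClass p m f =ᵐ[m] fun x => (f x).toReal := by
  rw [lpClass, dif_pos hf.memLp]
  exact hf.memLp.coeFn_toLp

theorem lpClass_eq [IsFiniteMeasure m] {f : E → ℝ≥0∞} (hf : EssBdd m f) {g : Lp ℝ p m}
    (h : (fun x => (f x).toReal) =ᵐ[m] g) : lpClass p m f = g :=
  Lp.ext ((coeFn_lpClass hf).trans h)

theorem lpClass_add [IsFiniteMeasure m] {f g : E → ℝ≥0∞} (hf : EssBdd m f) (hg : EssBdd m g) :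
    lpClass p m (f + g) = lpClass p m f + lpClass p m g := by
  refine lpClass_eq (hf.add hg) ?_
  filter_upwards [Lp.coeFn_add (lpClass p m f) (lpClass p m g), coeFn_lpClass (p := p) hf,
    coeFn_lpClass (p := p) hg, hf.ne_top, hg.ne_top] with x h1 h2 h3 h4 h5
  rw [h1, Pi.add_apply, Pi.add_apply, h2, h3, ENNReal.toReal_add h4 h5]

theorem lpClass_const_mul [IsFiniteMeasure m] (c : ℝ≥0) {f : E → ℝ≥0∞} (hf : EssBdd m f) :
    lpClass p m (fun x => c * f x) = (c : ℝ) • lpClass p m f := by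
  refine lpClass_eq (hf.const_mul c) ?_
  filter_upwards [Lp.coeFn_smul (c : ℝ) (lpClass p m f), coeFn_lpClass (p := p) hf] with x h1 h2
  rw [h1, Pi.smul_apply, h2]
  simp

theorem lpClass_mono [IsFiniteMeasure m] {f g : E → ℝ≥0∞} (hf : EssBdd m f) (hg : EssBdd m g)
    (h : f ≤ᵐ[m] g) : lpClass p m f ≤ lpClass p m g := by
  rw [← Lp.coeFn_le]
  filter_upwards [coeFn_lpClass (p := p) hf, coeFn_lpClass (p := p) hg, h, hg.ne_top]
    with x h1 h2 h3 h4
  rw [h1, h2]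
  exact ENNReal.toReal_mono h4 h3

theorem lpClass_nonneg [IsFiniteMeasure m] {f : E → ℝ≥0∞} (hf : EssBdd m f) :
    0 ≤ lpClass p m f := by
  rw [← Lp.coeFn_nonneg]
  filter_upwards [coeFn_lpClass (p := p) hf] with x h1
  rw [h1]
  exact ENNReal.toReal_nonneg

theorem lpClass_one [IsFiniteMeasure m] :
    lpClass p m (fun _ => 1) = Lp.const p m (1 : ℝ) := by
  refine lpClass_eq (by simpa using essBdd_const (m := m) 1) ?_
  filter_upwards [Lp.coeFn_const (p := p) (μ := m) (1 : ℝ)] with x hx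
  rw [hx]
  simp

theorem lpClass_indicator [IsFiniteMeasure m] {A : Set E} (hA : MeasurableSet A) :
    lpClass p m (A.indicator fun _ => 1) = indicatorConstLp p hA (measure_ne_top m A) (1 : ℝ) := by
  refine lpClass_eq (essBdd_indicator hA) ?_
  filter_upwards [indicatorConstLp_coeFn (p := p) (hs := hA) (hμs := measure_ne_top m A)
    (c := (1 : ℝ))] with x hx
  rw [hx]
  by_cases h : x ∈ A <;> simp [h]

/-- Indicators of disjoint sets sum up to the indicator of their union in `L^p`, for `p < ∞`. -/
theorem tendsto_lpClass_indicator_sum [IsFiniteMeasure m] [Fact (1 ≤ p)] (hp : p ≠ ∞)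
    {A : ℕ → Set E} (hA : ∀ k, MeasurableSet (A k)) (hd : Pairwise (Function.onFun Disjoint A)) :
    Tendsto (fun n => ∑ k ∈ Finset.range n, lpClass p m ((A k).indicator fun _ => 1)) atTop
      (𝓝 (lpClass p m ((⋃ k, A k).indicator fun _ => 1))) := by
  set B : ℕ → Set E := fun n => ⋃ k ∈ Finset.range n, A k
  have hB : ∀ n, MeasurableSet (B n) :=
    fun n => Finset.measurableSet_biUnion _ fun k _ => hA k
  have hU : MeasurableSet (⋃ k, A k) := MeasurableSet.iUnion hA
  have hsum : ∀ n, ∑ k ∈ Finset.range n, lpClass p m ((A k).indicator fun _ => 1) =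
      lpClass p m ((B n).indicator fun _ => 1) := by
    intro n
    induction n with
    | zero =>
      simp only [B, Finset.range_zero, Finset.sum_empty]
      refine (lpClass_eq (by simpa using essBdd_const (m := m) 0) ?_).symm
      filter_upwards [Lp.coeFn_zero ℝ p m] with x hx
      rw [hx]
      simp
    | succ n ih =>
      have hsucc : B (n + 1) = B n ∪ A n := by
        simp only [B, Finset.range_add_one, Finset.set_biUnion_insert, Set.union_comm]
      have hdis : Disjoint (B n) (A n) := by
        simp only [B, Set.disjoint_iUnion_left, Finset.mem_range]
        exact fun k hk => hd hk.ne
      rw [Finset.sum_range_succ, ih, hsucc, Set.indicator_union_of_disjoint hdis]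
      exact (lpClass_add (essBdd_indicator (hB n)) (essBdd_indicator (hA n))).symm
  simp_rw [hsum, lpClass_indicator (hB _), lpClass_indicator hU]
  -- For `p < ∞` it suffices that the symmetric differences have measure tending to zero, which is
  -- continuity of `m` from above.
  refine tendsto_indicatorConstLp_set hp ?_
  have hsub : ∀ n, B n ⊆ ⋃ k, A k := fun n => Set.iUnion₂_subset fun k _ => Set.subset_iUnion A k
  have hanti : Antitone fun n => (⋃ k, A k) \ B n := fun a b h =>
    Set.sdiff_subset_sdiff_right (Set.biUnion_subset_biUnion_left (Finset.range_subset_range.2 h))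
  have hempty : ⋂ n, (⋃ k, A k) \ B n = ∅ := by
    refine Set.eq_empty_of_forall_notMem fun x hx => ?_
    obtain ⟨k, hk⟩ := Set.mem_iUnion.1 (Set.mem_iInter.1 hx 0).1
    exact (Set.mem_iInter.1 hx (k + 1)).2 (Set.mem_biUnion (by simp) hk)
  have hlim := tendsto_measure_iInter_atTop (μ := m) (fun n => (hU.diff (hB n)).nullMeasurableSet)
    hanti ⟨0, measure_ne_top _ _⟩
  rw [hempty, measure_empty] at hlim
  refine hlim.congr fun n => ?_
  simp [symmDiff_def, Set.sdiff_eq_empty.2 (hsub n)]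

instance posSMulMono_Lp : PosSMulMono ℝ (Lp ℝ p m) where
  smul_le_smul_of_nonneg_left c hc f g h := by
    rw [← Lp.coeFn_le] at h ⊢
    filter_upwards [h, Lp.coeFn_smul c f, Lp.coeFn_smul c g] with x h1 h2 h3
    rw [h2, h3]
    exact mul_le_mul_of_nonneg_left h1 hc

/-- The operators on functions induced by operators on `L^p`. -/
noncomputable def lpOp (P : ℝ≥0 → Lp ℝ p m →ₗ[ℝ] Lp ℝ p m) (t : ℝ≥0) (f : E → ℝ≥0∞) (x : E) :
    ℝ≥0∞ :=
  ENNReal.ofReal (P t (lpClass p m f) x)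

theorem measurable_lpOp (P : ℝ≥0 → Lp ℝ p m →ₗ[ℝ] Lp ℝ p m) (t : ℝ≥0) (f : E → ℝ≥0∞) :
    Measurable (lpOp P t f) :=
  (Lp.stronglyMeasurable _).measurable.ennreal_ofReal

theorem lpOp_const_mul [IsFiniteMeasure m] (P : ℝ≥0 → Lp ℝ p m →ₗ[ℝ] Lp ℝ p m) (t : ℝ≥0)
    (c : ℝ≥0) {f : E → ℝ≥0∞} (hf : EssBdd m f) :
    lpOp P t (fun x => c * f x) =ᵐ[m] fun x => c * lpOp P t f x := by
  filter_upwards [Lp.coeFn_smul (c : ℝ) (P t (lpClass p m f))] with x hx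
  rw [lpOp, lpOp, lpClass_const_mul c hf, map_smul, hx, Pi.smul_apply, smul_eq_mul,
    ENNReal.ofReal_mul c.coe_nonneg, ENNReal.ofReal_coe_nnreal]

theorem massLp_eq_mass [Fact (1 ≤ p)] [IsFiniteMeasure m]
    (P : ℝ≥0 → Lp ℝ p m →ₗ[ℝ] Lp ℝ p m) : massLp p m P = mass m (lpOp P) := by
  ext t A
  rw [massLp, mass]
  simp only [lpOp, lpClass_indicator A.2]

/-! ### Markovian semigroups on `L^p` as Markov families. -/

namespace IsMarkovianC0Semigroup

variable [Fact (1 ≤ p)] [IsFiniteMeasure m] {P : ℝ≥0 → Lp ℝ p m →ₗ[ℝ] Lp ℝ p m}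

theorem mono (hP : IsMarkovianC0Semigroup p m P) (t : ℝ≥0) {f g : Lp ℝ p m} (h : f ≤ g) :
    P t f ≤ P t g := by
  have := hP.positive t (g - f) (sub_nonneg.2 h)
  rwa [map_sub, sub_nonneg] at this

theorem continuous (hP : IsMarkovianC0Semigroup p m P) (t : ℝ≥0) : Continuous (P t) := by
  obtain ⟨C, hC⟩ := exists_bound_of_positive (P t) (hP.positive t)
  exact AddMonoidHomClass.continuous_of_bound (P t) C hC

theorem apply_nonneg (hP : IsMarkovianC0Semigroup p m P) (t : ℝ≥0) {f : Lp ℝ p m} (h : 0 ≤ f) :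
    ∀ᵐ x ∂m, 0 ≤ P t f x :=
  (Lp.coeFn_nonneg _).2 (hP.positive t f h)

theorem apply_lpClass_nonneg (hP : IsMarkovianC0Semigroup p m P) (t : ℝ≥0) {f : E → ℝ≥0∞}
    (hf : EssBdd m f) : ∀ᵐ x ∂m, 0 ≤ P t (lpClass p m f) x :=
  hP.apply_nonneg t (lpClass_nonneg hf)

theorem lpOp_mono (hP : IsMarkovianC0Semigroup p m P) (t : ℝ≥0) {f g : E → ℝ≥0∞}
    (hf : EssBdd m f) (hg : EssBdd m g) (h : f ≤ᵐ[m] g) : lpOp P t f ≤ᵐ[m] lpOp P t g := by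
  filter_upwards [(Lp.coeFn_le _ _).2 (hP.mono t (lpClass_mono (p := p) hf hg h))] with x hx
  exact ENNReal.ofReal_le_ofReal hx

theorem lpOp_one (hP : IsMarkovianC0Semigroup p m P) (t : ℝ≥0) :
    lpOp P t (fun _ => 1) =ᵐ[m] fun _ => 1 := by
  filter_upwards [Lp.coeFn_const (p := p) (μ := m) (1 : ℝ)] with x hx
  rw [lpOp, lpClass_one, hP.map_one, hx]
  simp

theorem essBdd_lpOp (hP : IsMarkovianC0Semigroup p m P) (t : ℝ≥0) {f : E → ℝ≥0∞}
    (hf : EssBdd m f) : EssBdd m (lpOp P t f) := by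
  obtain ⟨C, hC⟩ := hf.2
  have h1 : EssBdd m fun _ : E => (1 : ℝ≥0∞) := by simpa using essBdd_const (m := m) 1
  refine ⟨measurable_lpOp P t f, C, ?_⟩
  filter_upwards [hP.lpOp_mono t hf (h1.const_mul C)
      (by filter_upwards [hC] with x hx; simpa using hx),
    lpOp_const_mul P t C h1, hP.lpOp_one t] with x h2 h3 h4
  rwa [h3, h4, mul_one] at h2

theorem lpClass_lpOp (hP : IsMarkovianC0Semigroup p m P) (t : ℝ≥0) {f : E → ℝ≥0∞}
    (hf : EssBdd m f) : lpClass p m (lpOp P t f) = P t (lpClass p m f) := by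
  refine lpClass_eq (hP.essBdd_lpOp t hf) ?_
  filter_upwards [hP.apply_lpClass_nonneg t hf] with x hx
  exact ENNReal.toReal_ofReal hx

/-- Continuity of `P t` gives convergence of the partial sums in `L^p`, hence almost everywhere
along a subsequence. The terms are nonnegative, so the whole series has that limit. -/
theorem lpOp_iUnion (hP : IsMarkovianC0Semigroup p m P) (hp : p ≠ ∞) (t : ℝ≥0) {A : ℕ → Set E}
    (hA : ∀ k, MeasurableSet (A k)) (hd : Pairwise (Function.onFun Disjoint A)) :
    lpOp P t ((⋃ k, A k).indicator fun _ => 1) =ᵐ[m]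
      fun x => ∑' k, lpOp P t ((A k).indicator fun _ => 1) x := by
  have hlim := ((hP.continuous t).tendsto _).comp (tendsto_lpClass_indicator_sum (m := m) hp hA hd)
  obtain ⟨ns, hns, hae⟩ := (tendstoInMeasure_of_tendsto_Lp hlim).exists_seq_tendsto_ae
  have hpart : ∀ n, ∀ᵐ x ∂m,
      P t (∑ k ∈ Finset.range n, lpClass p m ((A k).indicator fun _ => 1)) x =
        ∑ k ∈ Finset.range n, P t (lpClass p m ((A k).indicator fun _ => 1)) x := fun n => by
    rw [map_sum]
    exact Lp.coeFn_fun_finsetSum _ _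
  filter_upwards [hae, ae_all_iff.2 hpart,
    ae_all_iff.2 fun k => hP.apply_lpClass_nonneg t (essBdd_indicator (m := m) (hA k))]
    with x h1 h2 h3
  refine tendsto_nhds_unique ((ENNReal.continuous_ofReal.tendsto _).comp h1) ?_
  refine ((ENNReal.tendsto_nat_tsum _).comp hns.tendsto_atTop).congr fun i => ?_
  simp only [Function.comp_apply, h2, lpOp]
  exact (ENNReal.ofReal_sum_of_nonneg fun k _ => h3 k).symm

theorem lintegral_lpOp (hP : IsMarkovianC0Semigroup p m P) (t : ℝ≥0) {f : E → ℝ≥0∞}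
    (hf : EssBdd m f) :
    ∫⁻ x, lpOp P t f x ∂m = ENNReal.ofReal (∫ x, P t (lpClass p m f) x ∂m) :=
  (ofReal_integral_eq_lintegral_ofReal ((Lp.memLp _).integrable Fact.out)
    (hP.apply_lpClass_nonneg t hf)).symm

/-- On a finite measure space the `L^p` norm controls the `L^1` norm. With strong continuity this
gives measurability in time. -/
theorem continuous_integral_Lp : Continuous fun f : Lp ℝ p m => ∫ x, f x ∂m := by
  refine continuous_iff_continuousAt.2 fun f => ?_
  refine tendsto_integral_of_L1 _ ((Lp.memLp f).integrable Fact.out).aestronglyMeasurable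
    (Eventually.of_forall fun g => (Lp.memLp g).integrable Fact.out) ?_
  have hbound : ∀ g : Lp ℝ p m, ∫⁻ x, ‖g x - f x‖ₑ ∂m ≤
      ENNReal.ofReal ‖g - f‖ * m Set.univ ^ (1 / (1 : ℝ≥0∞).toReal - 1 / p.toReal) := fun g => by
    have h1 : ∫⁻ x, ‖g x - f x‖ₑ ∂m = eLpNorm (g - f : Lp ℝ p m) 1 m := by
      rw [eLpNorm_one_eq_lintegral_enorm]
      refine lintegral_congr_ae ?_
      filter_upwards [Lp.coeFn_sub g f] with x hx
      rw [hx, Pi.sub_apply]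
    rw [h1, Lp.norm_def, ENNReal.ofReal_toReal (Lp.eLpNorm_ne_top _)]
    exact eLpNorm_le_eLpNorm_mul_rpow_measure_univ Fact.out (Lp.aestronglyMeasurable _)
  refine tendsto_of_tendsto_of_tendsto_of_le_of_le tendsto_const_nhds ?_ (fun _ => zero_le) hbound
  have h0 : Tendsto (fun g : Lp ℝ p m => ENNReal.ofReal ‖g - f‖) (𝓝 f) (𝓝 0) := by
    have hc : Continuous fun g : Lp ℝ p m => ENNReal.ofReal ‖g - f‖ :=
      ENNReal.continuous_ofReal.comp (continuous_id.sub continuous_const).norm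
    simpa using hc.tendsto f
  have hfin : m Set.univ ^ (1 / (1 : ℝ≥0∞).toReal - 1 / p.toReal) ≠ ∞ := by
    refine ENNReal.rpow_ne_top_of_nonneg ?_ (measure_ne_top _ _)
    -- At `p = ∞` the conventions `∞.toReal = 0` and `1 / 0 = 0` make the exponent `1`, still
    -- nonnegative.
    rcases eq_or_ne p ∞ with rfl | hp
    · simp
    · have : 1 ≤ p.toReal := by
        simpa using ENNReal.toReal_mono hp (Fact.out : 1 ≤ p)
      simpa using inv_le_one_of_one_le₀ this
  simpa using ENNReal.Tendsto.mul_const h0 (Or.inr hfin)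

theorem isMarkovFamily (hP : IsMarkovianC0Semigroup p m P) (hp : p ≠ ∞) :
    IsMarkovFamily m (lpOp P) where
  measurable t _ f _ := measurable_lpOp P t f
  mono t _ f g hf hg h := hP.lpOp_mono t hf hg h
  add t _ f g hf hg := by
    filter_upwards [Lp.coeFn_add (P t (lpClass p m f)) (P t (lpClass p m g)),
      hP.apply_lpClass_nonneg t hf, hP.apply_lpClass_nonneg t hg] with x h1 h2 h3
    rw [Pi.add_apply, lpOp, lpClass_add hf hg, map_add, h1, Pi.add_apply, ENNReal.ofReal_add h2 h3]
    rfl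
  const_mul t _ c f hf := lpOp_const_mul P t c hf
  one t _ := hP.lpOp_one t
  semigroup s t _ _ f hf := by
    refine ae_of_all _ fun x => ?_
    rw [lpOp, lpOp, hP.lpClass_lpOp t hf, hP.add s t, LinearMap.comp_apply]
  iUnion t _ A hA hd := hP.lpOp_iUnion hp t hA hd
  time_measurable f hf := by
    simp_rw [hP.lintegral_lpOp _ hf]
    have h : Continuous fun s : ℝ => P s.toNNReal (lpClass p m f) :=
      (hP.strongly_continuous _).comp continuous_real_toNNReal
    exact (ENNReal.continuous_ofReal.comp (continuous_integral_Lp.comp h)).measurable.aemeasurable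

theorem integrable_apply (hP : IsMarkovianC0Semigroup p m P) (t : ℝ≥0) {f : E → ℝ≥0∞}
    (hf : EssBdd m f) {ν : Measure E} [IsFiniteMeasure ν] (hν : ν ≪ m) :
    Integrable (P t (lpClass p m f)) ν := by
  obtain ⟨C, hC⟩ := (hP.essBdd_lpOp t hf).2
  refine Integrable.of_bound (Lp.stronglyMeasurable _).aestronglyMeasurable C ?_
  filter_upwards [hν.ae_le hC, hν.ae_le (hP.apply_lpClass_nonneg t hf)] with x h1 h2
  rw [Real.norm_of_nonneg h2]
  rwa [lpOp, ENNReal.ofReal_le_coe] at h1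

theorem integral_apply_lpClass (hP : IsMarkovianC0Semigroup p m P) (t : ℝ≥0) {f : E → ℝ≥0∞}
    (hf : EssBdd m f) {ν : Measure E} (hν : ν ≪ m) :
    ∫ x, P t (lpClass p m f) x ∂ν = (∫⁻ x, lpOp P t f x ∂ν).toReal :=
  integral_eq_lintegral_of_nonneg_ae (hν.ae_le (hP.apply_lpClass_nonneg t hf))
    (Lp.stronglyMeasurable _).aestronglyMeasurable

theorem lintegral_lpOp_indicator (hP : IsMarkovianC0Semigroup p m P) {ν : Measure E}
    [IsFiniteMeasure ν] (hν : ν ≪ m) (h : IsInvariantLp p m P ν) {t : ℝ≥0} (ht : 0 < t)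
    {A : Set E} (hA : MeasurableSet A) :
    ∫⁻ x, lpOp P t (A.indicator fun _ => 1) x ∂ν = ν A := by
  have hA' := essBdd_indicator (m := m) hA
  have h1 := h t ht (A.indicator 1) (measurable_one.indicator hA) 1
    (by intro x; by_cases h : x ∈ A <;> simp [h])
  have h2 : bddToLp p m (A.indicator 1) (measurable_one.indicator hA) 1
      (by intro x; by_cases h : x ∈ A <;> simp [h]) = lpClass p m (A.indicator fun _ => 1) := by
    refine (lpClass_eq hA' ?_).symm
    rw [bddToLp]
    refine EventuallyEq.trans (ae_of_all _ fun x => ?_) (MemLp.coeFn_toLp _).symm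
    by_cases h : x ∈ A <;> simp [h]
  rw [h2, integral_indicator_one hA] at h1
  have h3 := ofReal_integral_eq_lintegral_ofReal (hP.integrable_apply t hA' hν)
    (hν.ae_le (hP.apply_lpClass_nonneg t hA'))
  rw [h1, measureReal_def, ENNReal.ofReal_toReal (measure_ne_top _ _)] at h3
  exact h3.symm

/-- Adding `C` makes `f` nonnegative with bound `2C`; as `P t` fixes constants, the shift cancels on
both sides. -/
theorem isInvariantLp_of_lintegral (hP : IsMarkovianC0Semigroup p m P) {ν : Measure E}
    [IsFiniteMeasure ν] (hν : ν ≪ m)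
    (h : ∀ s, 0 < s → ∀ f, EssBdd m f → ∫⁻ x, lpOp P s f x ∂ν = ∫⁻ x, f x ∂ν) :
    IsInvariantLp p m P ν := by
  intro t ht f hf C hC
  set F : E → ℝ≥0∞ := fun x => ENNReal.ofReal (f x + C)
  have hpos : ∀ x, 0 ≤ f x + C := fun x => by linarith [(abs_le.1 (hC x)).1]
  have hF : EssBdd m F := essBdd_of_le (C := (C + C).toNNReal)
    (hf.add_const C).ennreal_ofReal fun x =>
      ENNReal.ofReal_le_ofReal (by linarith [(abs_le.1 (hC x)).2])
  have hclass : bddToLp p m f hf C hC = lpClass p m F - C • Lp.const p m (1 : ℝ) := by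
    rw [eq_sub_iff_add_eq]
    refine (lpClass_eq hF ?_).symm
    filter_upwards [Lp.coeFn_add (bddToLp p m f hf C hC) (C • Lp.const p m (1 : ℝ)),
      Lp.coeFn_smul C (Lp.const p m (1 : ℝ)), Lp.coeFn_const (p := p) (μ := m) (1 : ℝ),
      MemLp.coeFn_toLp (MemLp.of_bound hf.aestronglyMeasurable C (ae_of_all m hC) : MemLp f p m)]
      with x h1 h2 h3 h4
    rw [h1, Pi.add_apply, h2, Pi.smul_apply, h3, bddToLp, h4, ENNReal.toReal_ofReal (hpos x)]
    simp
  have hae : P t (bddToLp p m f hf C hC) =ᵐ[m] fun x => P t (lpClass p m F) x - C := by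
    rw [hclass, map_sub, map_smul, hP.map_one]
    filter_upwards [Lp.coeFn_sub (P t (lpClass p m F)) (C • Lp.const p m (1 : ℝ)),
      Lp.coeFn_smul C (Lp.const p m (1 : ℝ)), Lp.coeFn_const (p := p) (μ := m) (1 : ℝ)]
      with x h1 h2 h3
    rw [h1, Pi.sub_apply, h2, Pi.smul_apply, h3]
    simp
  have hfint : Integrable f ν := Integrable.of_bound hf.aestronglyMeasurable C (ae_of_all _ hC)
  have hshift : ∫ x, P t (lpClass p m F) x ∂ν = ∫ x, (f x + C) ∂ν := by
    rw [hP.integral_apply_lpClass t hF hν, h t ht F hF, integral_eq_lintegral_of_nonneg_ae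
      (ae_of_all _ hpos) (hf.add_const C).aestronglyMeasurable]
  rw [integral_congr_ae (hν.ae_le hae), integral_sub (hP.integrable_apply t hF hν)
    (integrable_const C), hshift, integral_add hfint (integrable_const C), add_sub_cancel_right]

end IsMarkovianC0Semigroup

end Lp

end InvMeas

theorem theorem2p3 {E : Type*} [MeasurableSpace E] (m : Measure E) [IsFiniteMeasure m]
    (hm : m ≠ 0) :
    (∀ (p : ℝ≥0∞) [Fact (1 ≤ p)], p ≠ ∞ → ∀ P : ℝ≥0 → Lp ℝ p m →ₗ[ℝ] Lp ℝ p m,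
      InvMeas.IsMarkovianC0Semigroup p m P →
        List.TFAE [
          ∃ ν : Measure E, IsFiniteMeasure ν ∧ ν ≠ 0 ∧ ν ≪ m ∧ InvMeas.IsInvariantLp p m P ν,
          InvMeas.IsAlmostInvariant m (InvMeas.massLp p m P),
          ∀ t : ℕ → ℝ, InvMeas.IncreasesToInfinity t →
            InvMeas.IsMeanAlmostInvariant m (InvMeas.massLp p m P) t,
          ∀ t : ℕ → ℝ, InvMeas.IncreasesToInfinity t →
            InvMeas.index m (InvMeas.massLp p m P) t < m Set.univ,
          ∃ t : ℕ → ℝ, InvMeas.IncreasesToInfinity t ∧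
            InvMeas.index m (InvMeas.massLp p m P) t < m Set.univ]) ∧
    (∀ P : ℝ≥0 → Kernel E E,
      InvMeas.IsMeasurableMarkovianTransition P → InvMeas.IsAuxiliary m P →
        List.TFAE [
          ∃ ν : Measure E, IsFiniteMeasure ν ∧ ν ≠ 0 ∧ ν ≪ m ∧ InvMeas.IsInvariantKernel P ν,
          InvMeas.IsAlmostInvariant m (InvMeas.massKernel m P),
          ∀ t : ℕ → ℝ, InvMeas.IncreasesToInfinity t →
            InvMeas.IsMeanAlmostInvariant m (InvMeas.massKernel m P) t,
          ∀ t : ℕ → ℝ, InvMeas.IncreasesToInfinity t →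
            InvMeas.index m (InvMeas.massKernel m P) t < m Set.univ,
          ∃ t : ℕ → ℝ, InvMeas.IncreasesToInfinity t ∧
            InvMeas.index m (InvMeas.massKernel m P) t < m Set.univ]) := by
  refine ⟨fun p _ hp P hP => ?_, fun P hP haux => ?_⟩
  · rw [InvMeas.massLp_eq_mass]
    exact (hP.isMarkovFamily hp).tfae hm
      (fun ν _ hac h t ht A hA => hP.lintegral_lpOp_indicator hac h ht hA)
      (fun ν _ hac h => hP.isInvariantLp_of_lintegral hac h)
  · rw [InvMeas.massKernel_eq_mass]
    exact (InvMeas.isMarkovFamily_kernelOp hP haux).tfae hm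
      (fun ν _ _ h t ht A hA => h.lintegral_kernelOp_indicator hP ht hA)
      (fun ν _ _ h => InvMeas.isInvariantKernel_of_lintegral h)
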